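/- For a permutation $\pi$ of the $n$ coordinate positions let $(x,\pi)$ denote the transformation $y\mapsto x+\pi(y)$ of $\mathbb F_2^n$, and let $\mathrm{Aut}(\mathbb F_2^n)$ be the group of all these transformations, $x\in\mathbb F_2^n$, $\pi\in S_n$. For a code $C\subseteq\mathbb F_2^n$ let $\mathrm{Aut}(C)$ be the setwise stabilizer of $C$ in $\mathrm{Aut}(\mathbb F_2^n)$ and $\mathrm{Sym}(C)=\{\pi\in S_n:\pi(C)=C\}$. For a subgroup $G\le\mathrm{Aut}(\mathbb F_2^n)$ put $\Pi_G=\{\pi:(x,\pi)\in G \text{ for some } x\}$. A subgroup $H\le\mathrm{Aut}(\mathbb F_2^n)$ is narrow-sense embedded in a subgroup $G\le\mathrm{Aut}(\mathbb F_2^n)$ if $H\le G$ and $\Pi_G=\Pi_H$. Let $\mathcal N$ be a punctured Nordstrom–Robinson code of length $15$ containing the zero word, i.e. a code obtained from the Nordstrom–Robinson code of length $16$ (the Gray image of the octacode) by deleting one coordinate, up to a permutation of coordinates and a translation. Then $\mathcal N$ is contained in a binary Hamming code of length $15$, and for every binary Hamming code $\mathcal H_{15}$ of length $15$ (a linear code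 having a parity-check matrix whose columns are the $15$ nonzero vectors of $\mathbb F_2^4$, in some order) with $\mathcal N\subseteq\mathcal H_{15}$, the group $\mathrm{Aut}(\mathcal N)$ is narrow-sense embedded in $\mathrm{Aut}(\mathcal H_{15})$; moreover $$\Pi_{\mathrm{Aut}(\mathcal N)}=\mathrm{Sym}(\mathcal H_{15}).$$ -/

import Mathlib

namespace BinaryCode

/-- Words of length `n` over the two-element field. -/
abbrev Word (n : ℕ) : Type := Fin n → ZMod 2

/-- Permutations of the coordinate positions acting on words: position `π i` of `π(y)` carries the
symbol `y i`. (The other common convention, `π(y) = (y_{π(1)}, …, y_{π(n)})`, is this one with `π`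
replaced by its inverse; it yields the same subgroups of the symmetric group below.) -/
def permWord (n : ℕ) : Equiv.Perm (Fin n) →* MulAut (Multiplicative (Word n)) where
  toFun π :=
    { toFun := fun y => Multiplicative.ofAdd fun i => y.toAdd (π⁻¹ i)
      invFun := fun y => Multiplicative.ofAdd fun i => y.toAdd (π i)
      left_inv := fun y => by
        apply Multiplicative.toAdd.injective
        funext i
        simp
      right_inv := fun y => by
        apply Multiplicative.toAdd.injective
        funext i
        simp
      map_mul' := fun _ _ => rfl }
  map_one' := rfl
  map_mul' _ _ := rfl

/-- The automorphism group `Aut(F_2^n)` of the Hamming space: the pairs `(x, π)` of a word `x` and a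
permutation `π` of the coordinate positions, composed as the transformations `y ↦ x + π(y)`. -/
abbrev HammingAut (n : ℕ) : Type :=
  Multiplicative (Word n) ⋊[permWord n] Equiv.Perm (Fin n)

/-- The transformation `y ↦ x + π(y)` given by the pair `(x, π)`. -/
def HammingAut.act {n : ℕ} (g : HammingAut n) (y : Word n) : Word n :=
  fun i => g.left.toAdd i + y (g.right⁻¹ i)

theorem HammingAut.act_one {n : ℕ} (y : Word n) : HammingAut.act (1 : HammingAut n) y = y := by
  funext i
  simp [HammingAut.act]

theorem HammingAut.act_mul {n : ℕ} (g h : HammingAut n) (y : Word n) :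
    HammingAut.act (g * h) y = g.act (h.act y) := by
  funext i
  simp [HammingAut.act, permWord, add_assoc]

/-- `Aut(C)`: the setwise stabilizer of the code `C` in `Aut(F_2^n)`. -/
def autGroup {n : ℕ} (C : Set (Word n)) : Subgroup (HammingAut n) where
  carrier := {g | g.act '' C = C}
  one_mem' := by
    simp [HammingAut.act_one]
  mul_mem' := by
    intro g h hg hh
    simp only [Set.mem_ofPred_eq] at *
    have : HammingAut.act (g * h) = g.act ∘ h.act := funext (HammingAut.act_mul g h)
    rw [this, Set.image_comp, hh, hg]
  inv_mem' := by
    intro g hg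
    simp only [Set.mem_ofPred_eq] at *
    conv_lhs => rw [← hg]
    rw [← Set.image_comp]
    have : HammingAut.act g⁻¹ ∘ g.act = id := by
      funext y
      rw [Function.comp_apply, ← HammingAut.act_mul, inv_mul_cancel, HammingAut.act_one, id]
    rw [this, Set.image_id]

/-- `Sym(C)`: the permutations `π` of the coordinate positions with `π(C) = C`, that is, those for
which `(0, π)` is an automorphism of `C`. -/
def symGroup {n : ℕ} (C : Set (Word n)) : Subgroup (Equiv.Perm (Fin n)) :=
  (autGroup C).comap (SemidirectProduct.inr : Equiv.Perm (Fin n) →* HammingAut n)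

theorem mem_symGroup {n : ℕ} (C : Set (Word n)) (π : Equiv.Perm (Fin n)) :
    π ∈ symGroup C ↔ (fun y : Word n => y ∘ ⇑π⁻¹) '' C = C := by
  have h : HammingAut.act (SemidirectProduct.inr π : HammingAut n) =
      fun y : Word n => y ∘ ⇑π⁻¹ := by
    funext y i
    simp [HammingAut.act]
  change HammingAut.act (SemidirectProduct.inr π : HammingAut n) '' C = C ↔ _
  rw [h]

/-- `Π_G = {π : (x, π) ∈ G}`, the subgroup of permutation parts of `G ≤ Aut(F_2^n)`. -/
def permParts {n : ℕ} (G : Subgroup (HammingAut n)) : Subgroup (Equiv.Perm (Fin n)) :=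
  G.map SemidirectProduct.rightHom

/-- `H` is narrow-sense embedded in `G`, for subgroups of `Aut(F_2^n)`. -/
def NarrowSenseEmbedded {n : ℕ} (H G : Subgroup (HammingAut n)) : Prop :=
  H ≤ G ∧ permParts G = permParts H

/-- `C` is a binary Hamming code of redundancy `r`: it has a parity-check matrix whose columns are
the nonzero vectors of `F_2^r`, each occurring exactly once (so the length is `2^r - 1`). -/
def IsHammingCode (r : ℕ) {n : ℕ} (C : Submodule (ZMod 2) (Word n)) : Prop :=
  ∃ col : Fin n ≃ {v : Fin r → ZMod 2 // v ≠ 0},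
    ∀ y : Word n, y ∈ C ↔ ∑ i, y i • (col i : Fin r → ZMod 2) = 0

/-- A generator matrix of the octacode. -/
def octacodeGen : Matrix (Fin 4) (Fin 8) (ZMod 4) :=
  !![1, 0, 0, 0, 3, 1, 2, 1;
     0, 1, 0, 0, 1, 2, 3, 1;
     0, 0, 1, 0, 3, 3, 3, 2;
     0, 0, 0, 1, 2, 3, 1, 1]

/-- The octacode, the self-dual `ℤ/4`-linear code of length 8 with minimum Lee weight 6. -/
def octacode : Submodule (ZMod 4) (Fin 8 → ZMod 4) :=
  Submodule.span (ZMod 4) (Set.range octacodeGen)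

/-- The Gray map `0 ↦ 00`, `1 ↦ 01`, `2 ↦ 11`, `3 ↦ 10`. -/
def gray : ZMod 4 → Fin 2 → ZMod 2 :=
  ![![0, 0], ![0, 1], ![1, 1], ![1, 0]]

/-- The Nordstrom–Robinson code of length 16, the Gray image of the octacode; its coordinate
positions are indexed by `Fin 8 × Fin 2`. -/
def nordstromRobinson : Set (Fin 8 × Fin 2 → ZMod 2) :=
  {w | ∃ c ∈ octacode, ∀ p : Fin 8 × Fin 2, w p = gray (c p.1) p.2}

/-- `N` is a punctured Nordstrom–Robinson code: up to equivalence (a bijection of the coordinate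
positions and a translation) it arises from the Nordstrom–Robinson code by deleting one
coordinate position `p`. -/
def IsPuncturedNordstromRobinson (N : Set (Word 15)) : Prop :=
  ∃ (p : Fin 8 × Fin 2) (e : Fin 15 ≃ {q : Fin 8 × Fin 2 // q ≠ p}) (x : Word 15),
    N = {y | ∃ w ∈ nordstromRobinson, ∀ i, y i = x i + w (e i)}

end BinaryCode

/-!
The Gray image of an octacode word `r + 2s` (binary digits) has the bits `s` and `s + r` at the two
positions of each block. Label the 16 positions by the points of `F_2^4`, three coordinates being
the residues mod 2 of a column of the generator matrix and the fourth the bit inside the block. In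
these labels the Nordstrom–Robinson code is a Kerdock code: the functions on `F_2^4` of degree at
most 2 whose quadratic part lies in an explicit set of 8 (`mem_nordstromRobinson_iff`).
Three properties of this function code `K` carry the theorem.

* Every `f` in `K` satisfies `∑ f(v) v = 0` (`sum_smul_eq_zero_of_mem_kerdockCode`), because `f`
  times a coordinate has degree less than 4.
* A function orthogonal to `K` is affine (`affine_of_forall_sum_mul_eq_zero`): the 8 quadratic parts
  span all quadratic parts, so `K` spans the functions of degree at most 2, among which are the
  indicators of the affine planes.
* For an invertible matrix `A`, the code `K` composed with `A` is a translate of `K`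
  (`exists_add_comp_mulVec_mem_kerdockCode`). Such matrices are closed under products, and over
  `F_2` the transvections generate the general linear group, so only the 12 transvections have to
  be examined.

Since `K` is closed under composition with translations, the deleted position may be labelled `0`;
the remaining labels `b i` then run through the nonzero vectors. By the first property the Hamming
code with columns `b i` contains `N`. By the second property, any parity-check columns that
annihilate `N` are the image of the `b i` under an injective linear map
(`exists_linearMap_of_parity_check`). Hence there is only one Hamming code `H` containing `N`, and a
permutation which maps `N` into `H` acts on the labels linearly and therefore preserves `H`; this
gives `Aut(N) ≤ Aut(H)`. Conversely a permutation in `Sym(H)` acts on the labels linearly, and the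
third property provides a translation which completes it to an automorphism of `N`.
-/

namespace BinaryCode

open Matrix

/-! ### The Nordstrom–Robinson code as a Kerdock code -/

/-- The function of degree at most 2 on `F_2^4` with constant term `c`, linear coefficients `l` and
quadratic coefficients `m`, the latter in the order `v₀v₁, v₀v₂, v₀v₃, v₁v₂, v₁v₃, v₂v₃`. -/
def quadFun (m : Fin 6 → ZMod 2) (l : Word 4) (c : ZMod 2) (v : Word 4) : ZMod 2 :=
  c + (l 0 * v 0 + l 1 * v 1 + l 2 * v 2 + l 3 * v 3) +
    (m 0 * (v 0 * v 1) + m 1 * (v 0 * v 2) + m 2 * (v 0 * v 3) +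
      m 3 * (v 1 * v 2) + m 4 * (v 1 * v 3) + m 5 * (v 2 * v 3))

/-- The 8 quadratic parts of the Kerdock code, parametrized by the coefficients `p, q, r` of
`v₀v₃, v₁v₃, v₂v₃`. The coefficients of the other monomials depend on them nonlinearly. -/
def kerdock (p q r : ZMod 2) : Fin 6 → ZMod 2 :=
  ![r + p * q, q + r + p * r, p, p + q + r + q * r, q, r]

/-- The Kerdock code of length 16, as a set of functions on `F_2^4`: the union of 8 cosets of the
affine functions. -/
def kerdockCode : Set (Word 4 → ZMod 2) :=
  {f | ∃ p q r l c, f = quadFun (kerdock p q r) l c}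

/-- The labelling of the positions of the Nordstrom–Robinson code by the points of `F_2^4`. Its first
three coordinates are rows of the octacode generator matrix mod 2; the fourth row is redundant,
since the four rows add up to the all-one word mod 2. -/
def label (q : Fin 8 × Fin 2) : Word 4 :=
  ![((octacodeGen 0 q.1).val : ZMod 2), ((octacodeGen 1 q.1).val : ZMod 2),
    ((octacodeGen 2 q.1).val : ZMod 2), ((q.2 : ℕ) : ZMod 2)]

/-- The element `r + 2s` of `ℤ/4`, whose Gray image is `(s, s + r)`. -/
def digits (s r : ZMod 2) : ZMod 4 := (r.val : ZMod 4) + 2 * (s.val : ZMod 4)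

theorem word_four_eq (v : Word 4) : v = ![v 0, v 1, v 2, v 3] := by
  funext i
  fin_cases i <;> rfl

theorem label_bijective : Function.Bijective label := by
  constructor
  · unfold Function.Injective
    decide +kernel
  · unfold Function.Surjective
    decide +kernel

/-- The Gray image of the octacode word with coefficients `rᵢ + 2sᵢ`, in the parameters
`p = r₀ + r₃`, `q = r₁ + r₃`, `r = r₂ + r₃`, `lᵢ = sᵢ + s₃` for `i < 3`, `l₃ = r₃` and `c = s₃`. -/
theorem gray_octacode_eq_quadFun (p q r l0 l1 l2 l3 c : ZMod 2) : ∀ k b,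
    gray (digits (l0 + c) (p + l3) * octacodeGen 0 k + digits (l1 + c) (q + l3) * octacodeGen 1 k +
      digits (l2 + c) (r + l3) * octacodeGen 2 k + digits c l3 * octacodeGen 3 k) b =
    quadFun (kerdock p q r) ![l0, l1, l2, l3] c (label (k, b)) := by
  revert p q r l0 l1 l2 l3 c
  decide +kernel

theorem exists_digits (z : ZMod 4) : ∃ s r, digits s r = z := by
  revert z
  decide +kernel

theorem mem_octacode_iff (c : Fin 8 → ZMod 4) :
    c ∈ octacode ↔ ∃ u : Fin 4 → ZMod 4, ∀ k, c k =
      u 0 * octacodeGen 0 k + u 1 * octacodeGen 1 k + u 2 * octacodeGen 2 k +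
        u 3 * octacodeGen 3 k := by
  refine (Submodule.mem_span_range_iff_exists_fun (ZMod 4) (v := fun i => octacodeGen i)).trans ?_
  refine exists_congr fun u => ?_
  rw [funext_iff]
  refine forall_congr' fun k => ?_
  rw [Finset.sum_apply, Fin.sum_univ_four]
  simp only [Pi.smul_apply, smul_eq_mul]
  exact eq_comm

theorem mem_nordstromRobinson_iff (w : Fin 8 × Fin 2 → ZMod 2) :
    w ∈ nordstromRobinson ↔ ∃ f ∈ kerdockCode, ∀ q, w q = f (label q) := by
  constructor
  · rintro ⟨c, hc, hw⟩
    obtain ⟨u, hu⟩ := (mem_octacode_iff c).1 hc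
    choose s r hsr using fun i => exists_digits (u i)
    refine ⟨_, ⟨r 0 + r 3, r 1 + r 3, r 2 + r 3, ![s 0 + s 3, s 1 + s 3, s 2 + s 3, r 3], s 3, rfl⟩,
      fun q => ?_⟩
    have h2 (a b : ZMod 2) : a + b + b = a := by rw [add_assoc, CharTwo.add_self_eq_zero, add_zero]
    have := gray_octacode_eq_quadFun (r 0 + r 3) (r 1 + r 3) (r 2 + r 3)
      (s 0 + s 3) (s 1 + s 3) (s 2 + s 3) (r 3) (s 3) q.1 q.2
    rw [hw q, hu, ← this]
    simp only [h2, hsr]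
  · rintro ⟨f, ⟨p, q, r, l, c, rfl⟩, hw⟩
    refine ⟨_, (mem_octacode_iff _).2 ⟨![digits (l 0 + c) (p + l 3), digits (l 1 + c) (q + l 3),
      digits (l 2 + c) (r + l 3), digits c (l 3)], fun k => rfl⟩, fun x => ?_⟩
    rw [hw, word_four_eq l]
    exact (gray_octacode_eq_quadFun p q r (l 0) (l 1) (l 2) (l 3) c x.1 x.2).symm

theorem zero_mem_kerdockCode : (fun _ => 0) ∈ kerdockCode :=
  ⟨0, 0, 0, 0, 0, by funext v; simp [quadFun, kerdock]⟩

/-! ### Affine transformations of the Kerdock code -/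

theorem comp_add_mem_kerdockCode {f : Word 4 → ZMod 2} (hf : f ∈ kerdockCode) (t : Word 4) :
    (fun v => f (v + t)) ∈ kerdockCode := by
  obtain ⟨p, q, r, l, c, rfl⟩ := hf
  refine ⟨p, q, r, ?_, quadFun (kerdock p q r) l c t, ?_⟩
  · exact
      let m := kerdock p q r
      ![l 0 + m 0 * t 1 + m 1 * t 2 + m 2 * t 3, l 1 + m 0 * t 0 + m 3 * t 2 + m 4 * t 3,
        l 2 + m 1 * t 0 + m 3 * t 1 + m 5 * t 3, l 3 + m 2 * t 0 + m 4 * t 1 + m 5 * t 2]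
  · funext v
    simp only [quadFun, Pi.add_apply, cons_val]
    ring

theorem quadFun_eq_add (m : Fin 6 → ZMod 2) (l : Word 4) (c : ZMod 2) (v : Word 4) :
    quadFun m l c v = quadFun m 0 0 v + l ⬝ᵥ v + c := by
  simp only [quadFun, dotProduct, Fin.sum_univ_four, Pi.zero_apply]
  ring

/-- Substituting `xᵢ + xⱼ` for `xᵢ` permutes the quadratic parts of the Kerdock code up to adding a
fixed one. The only linear term that arises is a multiple of `xⱼ`, from the monomial `xᵢxⱼ`. -/
theorem exists_quadFun_kerdock_comp_transvection : ∀ i j : Fin 4, i ≠ j → ∃ p q r, ∀ p' q' r',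
    ∃ p'' q'' r'' t, ∀ x0 x1 x2 x3,
      quadFun (kerdock p q r) 0 0 ![x0, x1, x2, x3] +
        quadFun (kerdock p' q' r') 0 0
          (![x0, x1, x2, x3] + Pi.single i (![x0, x1, x2, x3] j)) =
      quadFun (kerdock p'' q'' r'') (Pi.single j t) 0 ![x0, x1, x2, x3] := by
  decide +kernel

theorem exists_add_comp_mulVec_mem_kerdockCode (A : Matrix (Fin 4) (Fin 4) (ZMod 2))
    (hA : A.det ≠ 0) :
    ∃ g : Word 4 → ZMod 2, ∀ f ∈ kerdockCode, (fun v => g v + f (A *ᵥ v)) ∈ kerdockCode := by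
  refine diagonal_transvection_induction_of_det_ne_zero
    (fun A => ∃ g : Word 4 → ZMod 2, ∀ f ∈ kerdockCode, (fun v => g v + f (A *ᵥ v)) ∈ kerdockCode)
    A hA (fun D hD => ?_) (fun s => ?_) fun A B _ _ ihA ihB => ?_
  · -- over `F_2` the identity is the only invertible diagonal matrix
    have hD1 : D = 1 := by
      funext i
      rw [det_diagonal, Finset.prod_ne_zero_iff] at hD
      have := hD i (Finset.mem_univ i)
      rw [Pi.one_apply]
      revert this
      generalize D i = d
      revert d
      decide
    refine ⟨fun _ => 0, fun f hf => ?_⟩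
    subst hD1
    simpa using hf
  · obtain ⟨i, j, hij, c⟩ := s
    have hT (v : Word 4) : (TransvectionStruct.mk i j hij c).toMatrix *ᵥ v =
        v + Pi.single i (c * v j) := by
      rw [TransvectionStruct.toMatrix_mk, transvection, add_mulVec, one_mulVec, single_mulVec]
      rfl
    simp only [hT]
    obtain rfl | rfl : c = 0 ∨ c = 1 := by
      clear hT
      revert c
      decide
    · exact ⟨fun _ => 0, fun f hf => by simpa using hf⟩
    obtain ⟨p, q, r, h⟩ := exists_quadFun_kerdock_comp_transvection i j hij
    refine ⟨quadFun (kerdock p q r) 0 0, ?_⟩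
    rintro f ⟨p', q', r', l, c, rfl⟩
    obtain ⟨p'', q'', r'', t, h⟩ := h p' q' r'
    refine ⟨p'', q'', r'', Pi.single j t + l + Pi.single j (l i), c, funext fun v => ?_⟩
    have hv := h (v 0) (v 1) (v 2) (v 3)
    rw [← word_four_eq, quadFun_eq_add _ (Pi.single j t)] at hv
    rw [quadFun_eq_add _ l, quadFun_eq_add _ (_ + _), one_mul, ← add_assoc, ← add_assoc, hv]
    simp only [add_dotProduct, dotProduct_add, single_dotProduct, dotProduct_single]
    ring
  · obtain ⟨g, hg⟩ := ihA
    obtain ⟨g', hg'⟩ := ihB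
    refine ⟨fun v => g' v + g (B *ᵥ v), fun f hf => ?_⟩
    have := hg' _ (hg f hf)
    simpa only [mulVec_mulVec, add_assoc] using this

/-! ### The dual of the Kerdock code -/

theorem sum_quadFun_mul (m : Fin 6 → ZMod 2) (l : Word 4) (c : ZMod 2) (h : Word 4 → ZMod 2) :
    ∑ v, quadFun m l c v * h v = c * ∑ v, h v +
      (l 0 * ∑ v, v 0 * h v + l 1 * ∑ v, v 1 * h v + l 2 * ∑ v, v 2 * h v +
        l 3 * ∑ v, v 3 * h v) +
      (m 0 * ∑ v, v 0 * v 1 * h v + m 1 * ∑ v, v 0 * v 2 * h v + m 2 * ∑ v, v 0 * v 3 * h v +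
        m 3 * ∑ v, v 1 * v 2 * h v + m 4 * ∑ v, v 1 * v 3 * h v +
        m 5 * ∑ v, v 2 * v 3 * h v) := by
  simp only [Finset.mul_sum, ← Finset.sum_add_distrib]
  refine Finset.sum_congr rfl fun v _ => ?_
  simp only [quadFun]
  ring

theorem sum_smul_eq_zero_of_mem_kerdockCode {f : Word 4 → ZMod 2} (hf : f ∈ kerdockCode) :
    ∑ v, f v • v = 0 := by
  obtain ⟨p, q, r, l, c, rfl⟩ := hf
  have h0 : ∀ k : Fin 4, ∑ v : Word 4, v k = 0 := by decide +kernel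
  have h1 : ∀ i k : Fin 4, ∑ v : Word 4, v i * v k = 0 := by decide +kernel
  have h2 : ∀ i j k : Fin 4, ∑ v : Word 4, v i * v j * v k = 0 := by decide +kernel
  funext k
  simp only [Finset.sum_apply, Pi.smul_apply, smul_eq_mul, sum_quadFun_mul, h0, h1, h2, mul_zero,
    add_zero, Pi.zero_apply]

/-- The 8 quadratic parts of the Kerdock code span the space of all quadratic parts. -/
theorem eq_zero_of_kerdock_relation : ∀ a0 a1 a2 a3 a4 a5 : ZMod 2,
    (∀ p q r, kerdock p q r 0 * a0 + kerdock p q r 1 * a1 + kerdock p q r 2 * a2 +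
      kerdock p q r 3 * a3 + kerdock p q r 4 * a4 + kerdock p q r 5 * a5 = 0) →
    a0 = 0 ∧ a1 = 0 ∧ a2 = 0 ∧ a3 = 0 ∧ a4 = 0 ∧ a5 = 0 := by
  decide +kernel

/-- The Kerdock code spans the functions of degree at most 2, stated dually: whatever is orthogonal
to the code is orthogonal to all of these functions. -/
theorem sum_quadFun_mul_eq_zero {h : Word 4 → ZMod 2}
    (hh : ∀ f ∈ kerdockCode, ∑ v, f v * h v = 0) (m : Fin 6 → ZMod 2) (l : Word 4) (c : ZMod 2) :
    ∑ v, quadFun m l c v * h v = 0 := by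
  have key (p q r : ZMod 2) (l : Word 4) (c : ZMod 2) :
      ∑ v, quadFun (kerdock p q r) l c v * h v = 0 := hh _ ⟨p, q, r, l, c, rfl⟩
  simp only [sum_quadFun_mul] at key ⊢
  have k0 : kerdock 0 0 0 = 0 := by decide
  have e : ∑ v, h v = 0 := by simpa [k0] using key 0 0 0 0 1
  have e0 : ∑ v, v 0 * h v = 0 := by simpa [k0] using key 0 0 0 ![1, 0, 0, 0] 0
  have e1 : ∑ v, v 1 * h v = 0 := by simpa [k0] using key 0 0 0 ![0, 1, 0, 0] 0
  have e2 : ∑ v, v 2 * h v = 0 := by simpa [k0] using key 0 0 0 ![0, 0, 1, 0] 0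
  have e3 : ∑ v, v 3 * h v = 0 := by simpa [k0] using key 0 0 0 ![0, 0, 0, 1] 0
  obtain ⟨d0, d1, d2, d3, d4, d5⟩ := eq_zero_of_kerdock_relation _ _ _ _ _ _ fun p q r => by
    simpa using key p q r 0 0
  simp only [e, e0, e1, e2, e3, d0, d1, d2, d3, d4, d5, mul_zero, add_zero]

/-- The indicator function of the plane `{0, u, v, u + v}`, as a sum of four point indicators. -/
def flatIndicator (u v x : Word 4) : ZMod 2 :=
  (if x = u + v then 1 else 0) + (if x = u then 1 else 0) + (if x = v then 1 else 0) +
    (if x = 0 then 1 else 0)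

/-- A plane of `F_2^4` is cut out by two linear equations, so its indicator has degree 2. -/
theorem exists_quadFun_eq_flatIndicator (u v : Word 4) (hu : u ≠ 0) (hv : v ≠ 0) (huv : u ≠ v) :
    ∃ m l c, ∀ x, flatIndicator u v x = quadFun m l c x := by
  have key : ∀ u v : Word 4, u ≠ 0 → v ≠ 0 → u ≠ v → ∀ x,
      -- the coefficients are those of the Möbius inversion of `f`
      let f := flatIndicator u v
      let e : Fin 4 → Word 4 := fun i => Pi.single i 1
      let d : Fin 4 → Fin 4 → ZMod 2 := fun i j => f (e i + e j) + f (e i) + f (e j) + f 0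
      f x = quadFun ![d 0 1, d 0 2, d 0 3, d 1 2, d 1 3, d 2 3] (fun i => f (e i) + f 0) (f 0) x :=
    by decide +kernel
  exact ⟨_, _, _, key u v hu hv huv⟩

/-- A function orthogonal to the Kerdock code is affine: its values sum to zero on every plane. -/
theorem affine_of_forall_sum_mul_eq_zero {h : Word 4 → ZMod 2}
    (hh : ∀ f ∈ kerdockCode, ∑ v, f v * h v = 0) (u v : Word 4) :
    h (u + v) + h u + h v + h 0 = 0 := by
  have two (a : ZMod 2) : a + a = 0 := CharTwo.add_self_eq_zero a
  by_cases hu : u = 0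
  · subst hu
    rw [zero_add, add_assoc (h v + h 0), two]
  by_cases hv : v = 0
  · subst hv
    rw [add_zero, two, zero_add, two]
  by_cases huv : u = v
  · subst huv
    rw [add_assoc (h _), two, CharTwo.add_self_eq_zero u, add_zero, two]
  obtain ⟨m, l, c, hf⟩ := exists_quadFun_eq_flatIndicator u v hu hv huv
  have := sum_quadFun_mul_eq_zero hh m l c
  simpa [← hf, flatIndicator, add_mul, Finset.sum_add_distrib] using this

/-! ### Automorphism groups -/

theorem HammingAut.act_injective {n : ℕ} (g : HammingAut n) : Function.Injective g.act := by
  intro y z h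
  rw [← HammingAut.act_one y, ← HammingAut.act_one z, ← inv_mul_cancel g, HammingAut.act_mul,
    HammingAut.act_mul, h]

/-- As codes are finite, mapping `C` into itself suffices for `g` to stabilize `C`. -/
theorem mem_autGroup_iff {n : ℕ} (C : Set (Word n)) (g : HammingAut n) :
    g ∈ autGroup C ↔ ∀ y ∈ C, g.act y ∈ C := by
  change g.act '' C = C ↔ _
  refine Iff.trans ?_ Set.mapsTo_iff_image_subset.symm
  refine ⟨fun h => h.subset, fun h => Set.eq_of_subset_of_ncard_le h ?_ C.toFinite⟩
  rw [Set.ncard_image_of_injective _ g.act_injective]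

theorem mem_symGroup_iff {n : ℕ} (C : Set (Word n)) (π : Equiv.Perm (Fin n)) :
    π ∈ symGroup C ↔ ∀ y ∈ C, y ∘ ⇑π⁻¹ ∈ C := by
  have h (y : Word n) : HammingAut.act (SemidirectProduct.inr π : HammingAut n) y = y ∘ ⇑π⁻¹ := by
    funext i
    simp [HammingAut.act]
  simp only [symGroup, Subgroup.mem_comap, mem_autGroup_iff, h]

theorem HammingAut.act_eq_act_zero_add {n : ℕ} (g : HammingAut n) (y : Word n) :
    g.act y = g.act 0 + y ∘ ⇑g.right⁻¹ := by
  funext i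
  simp [HammingAut.act]

/-- For a linear code, the word part of an automorphism lies in the code and can be dropped. -/
theorem permParts_autGroup_submodule {n : ℕ} (H : Submodule (ZMod 2) (Word n)) :
    permParts (autGroup (H : Set (Word n))) = symGroup (H : Set (Word n)) := by
  ext π
  constructor
  · rintro ⟨g, hg, rfl⟩
    rw [mem_symGroup_iff]
    intro y hy
    have hg := (mem_autGroup_iff _ _).1 hg
    have h := hg y hy
    rw [HammingAut.act_eq_act_zero_add] at h
    exact (H.add_mem_iff_right (hg 0 H.zero_mem)).1 h
  · exact fun h => ⟨SemidirectProduct.inr π, h, rfl⟩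

/-! ### The punctured code and its Hamming code -/

/-- The translate by `f₀` of the Kerdock code punctured at the point `0`, the remaining points being
listed by `b`. -/
def puncturedKerdock (b : Fin 15 ≃ {v : Word 4 // v ≠ 0}) (f₀ : Word 4 → ZMod 2) :
    Set (Word 15) :=
  {y | ∃ f ∈ kerdockCode, ∀ i, y i = f₀ (b i) + f (b i)}

/-- Translating the labels moves the deleted position to `0`. As `N` contains the zero word, the
translation in its definition is by a codeword. -/
theorem IsPuncturedNordstromRobinson.exists_eq_puncturedKerdock {N : Set (Word 15)}
    (hN : IsPuncturedNordstromRobinson N) (h0 : (0 : Word 15) ∈ N) :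
    ∃ b, ∃ f₀ ∈ kerdockCode, N = puncturedKerdock b f₀ := by
  obtain ⟨p, e, x, rfl⟩ := hN
  have two (a : Word 4) : a + label p + label p = a := by
    rw [add_assoc, CharTwo.add_self_eq_zero, add_zero]
  let T : Fin 8 × Fin 2 ≃ Word 4 :=
    (Equiv.ofBijective label label_bijective).trans (Equiv.addRight (label p))
  have hTp : T p = 0 := CharTwo.add_self_eq_zero _
  let b : Fin 15 ≃ {v : Word 4 // v ≠ 0} :=
    e.trans (T.subtypeEquiv fun q => by rw [← hTp, T.injective.ne_iff])
  have hb (i) : label (e i) = (b i : Word 4) + label p := (two _).symm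
  obtain ⟨w₀, hw₀, hx⟩ := h0
  obtain ⟨f₀, hf₀, hwf⟩ := (mem_nordstromRobinson_iff w₀).1 hw₀
  refine ⟨b, fun v => f₀ (v + label p), comp_add_mem_kerdockCode hf₀ _, ?_⟩
  have hx' (i) : x i = f₀ (b i + label p) := by
    rw [← hb, ← hwf]
    exact CharTwo.add_eq_zero.1 (hx i).symm
  ext y
  constructor
  · rintro ⟨w, hw, hy⟩
    obtain ⟨f, hf, hwf⟩ := (mem_nordstromRobinson_iff w).1 hw
    refine ⟨_, comp_add_mem_kerdockCode hf (label p), fun i => ?_⟩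
    rw [hy, hx', hwf, hb]
  · rintro ⟨f, hf, hy⟩
    refine ⟨fun q => f (label q + label p), (mem_nordstromRobinson_iff _).2
      ⟨_, comp_add_mem_kerdockCode hf (label p), fun q => rfl⟩, fun i => ?_⟩
    simp only [hy, hx', hb, two]

theorem sum_comp_equiv_ne_zero (b : Fin 15 ≃ {v : Word 4 // v ≠ 0}) {M : Type*} [AddCommMonoid M]
    (F : Word 4 → M) (hF : F 0 = 0) : ∑ i, F (b i) = ∑ v, F v := by
  rw [Equiv.sum_comp b fun v => F v, ← Finset.sum_subtype (Finset.univ.filter (· ≠ 0)) (by simp)]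
  refine Finset.sum_filter_of_ne fun v _ hv h => hv ?_
  rw [h, hF]

theorem sum_smul_eq_zero_of_mem_puncturedKerdock {b : Fin 15 ≃ {v : Word 4 // v ≠ 0}}
    {f₀ : Word 4 → ZMod 2} (hf₀ : f₀ ∈ kerdockCode) {y : Word 15}
    (hy : y ∈ puncturedKerdock b f₀) : ∑ i, y i • (b i : Word 4) = 0 := by
  obtain ⟨f, hf, hy⟩ := hy
  simp only [hy]
  rw [sum_comp_equiv_ne_zero b (fun v => (f₀ v + f v) • v) (smul_zero _)]
  simp only [add_smul, Finset.sum_add_distrib, sum_smul_eq_zero_of_mem_kerdockCode hf,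
    sum_smul_eq_zero_of_mem_kerdockCode hf₀, add_zero]

/-- Parity-check columns annihilating the punctured code are unique up to an injective linear map. -/
theorem exists_linearMap_of_parity_check (b c : Fin 15 ≃ {v : Word 4 // v ≠ 0})
    (f₀ : Word 4 → ZMod 2)
    (h : ∀ y ∈ puncturedKerdock b f₀, ∑ i, y i • (c i : Word 4) = 0) :
    ∃ L : Word 4 →ₗ[ZMod 2] Word 4, Function.Injective L ∧ ∀ i, L (b i) = c i := by
  -- extend `b i ↦ c i` by `0 ↦ 0`; each coordinate is then orthogonal to the Kerdock code
  let F : Word 4 → Word 4 := fun v => if hv : v ≠ 0 then c (b.symm ⟨v, hv⟩) else 0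
  have F0 : F 0 = 0 := dif_neg (by simp)
  have Fb (i) : F (b i) = c i := by
    simp only [F, dif_pos (b i).2, Subtype.coe_eta, Equiv.symm_apply_apply]
  have hsum (f) (hf : f ∈ kerdockCode) : ∑ v, (f₀ v + f v) • F v = 0 := by
    rw [← sum_comp_equiv_ne_zero b _ (by rw [F0, smul_zero])]
    simp only [Fb]
    exact h _ ⟨f, hf, fun _ => rfl⟩
  have hF (f) (hf : f ∈ kerdockCode) : ∑ v, f v • F v = 0 := by
    have h0 := hsum _ zero_mem_kerdockCode
    simp only [add_zero] at h0
    simpa only [add_smul, Finset.sum_add_distrib, h0, zero_add] using hsum f hf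
  have hadd (u v : Word 4) : F (u + v) = F u + F v := by
    funext k
    have := affine_of_forall_sum_mul_eq_zero (h := fun v => F v k)
      (fun f hf => by simpa using congrFun (hF f hf) k) u v
    simp only [F0, Pi.zero_apply, add_zero] at this
    rw [add_assoc] at this
    exact CharTwo.add_eq_zero.1 this
  refine ⟨(AddMonoidHom.mk' F hadd).toZModLinearMap 2, ?_, Fb⟩
  rw [injective_iff_map_eq_zero]
  intro v hv
  by_contra hv0
  have := Fb (b.symm ⟨v, hv0⟩)
  rw [Equiv.apply_symm_apply] at this
  exact (c _).2 (this.symm.trans hv)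

/-- There is only one Hamming code containing the punctured code. -/
theorem mem_hamming_iff_of_puncturedKerdock_subset {b : Fin 15 ≃ {v : Word 4 // v ≠ 0}}
    {f₀ : Word 4 → ZMod 2} {H : Submodule (ZMod 2) (Word 15)} (hH : IsHammingCode 4 H)
    (hN : puncturedKerdock b f₀ ⊆ (H : Set (Word 15))) (y : Word 15) :
    y ∈ H ↔ ∑ i, y i • (b i : Word 4) = 0 := by
  obtain ⟨col, hcol⟩ := hH
  obtain ⟨L, hL, hLb⟩ := exists_linearMap_of_parity_check b col f₀ fun y hy => (hcol y).1 (hN hy)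
  rw [hcol, ← map_eq_zero_iff L hL (x := ∑ i, y i • (b i : Word 4)), map_sum]
  simp only [map_smul, hLb]

theorem sum_comp_perm_inv_smul {n : ℕ} {M : Type*} [AddCommMonoid M] [Module (ZMod 2) M]
    (π : Equiv.Perm (Fin n)) (y : Word n) (a : Fin n → M) :
    ∑ i, (y ∘ ⇑π⁻¹) i • a i = ∑ i, y i • a (π i) := by
  rw [← Equiv.sum_comp π]
  simp

/-- A permutation mapping the punctured code into its Hamming code acts on the labels linearly. -/
theorem exists_linearMap_of_perm {b : Fin 15 ≃ {v : Word 4 // v ≠ 0}} {f₀ : Word 4 → ZMod 2}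
    {π : Equiv.Perm (Fin 15)}
    (h : ∀ y ∈ puncturedKerdock b f₀, ∑ i, (y ∘ ⇑π⁻¹) i • (b i : Word 4) = 0) :
    ∃ L : Word 4 →ₗ[ZMod 2] Word 4, Function.Injective L ∧ ∀ i, L (b i) = b (π i) := by
  refine exists_linearMap_of_parity_check b (π.trans b) f₀ fun y hy => ?_
  exact (sum_comp_perm_inv_smul π y fun i => (b i : Word 4)).symm.trans (h y hy)

/-- A permutation acting linearly on the labels is the permutation part of an automorphism of the
punctured code. -/
theorem mem_permParts_autGroup_puncturedKerdock {b : Fin 15 ≃ {v : Word 4 // v ≠ 0}}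
    {f₀ : Word 4 → ZMod 2} {π : Equiv.Perm (Fin 15)} {L : Word 4 →ₗ[ZMod 2] Word 4}
    (hL : Function.Injective L) (hLb : ∀ i, L (b i) = b (π i)) :
    π ∈ permParts (autGroup (puncturedKerdock b f₀)) := by
  let E : Word 4 ≃ₗ[ZMod 2] Word 4 := LinearEquiv.ofInjectiveEndo L hL
  have hE (i) : E.symm (b i) = b (π⁻¹ i) := by
    rw [LinearEquiv.symm_apply_eq]
    simp [E, hLb]
  obtain ⟨g, hg⟩ := exists_add_comp_mulVec_mem_kerdockCode
    (LinearMap.toMatrix' (E.symm : Word 4 →ₗ[ZMod 2] Word 4)) (by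
      rw [LinearMap.det_toMatrix']
      exact (LinearEquiv.isUnit_det' E.symm).ne_zero)
  simp only [LinearMap.toMatrix'_mulVec, LinearEquiv.coe_coe] at hg
  -- with `g + f ∘ L⁻¹` in the Kerdock code, the word `f₀ + g + f₀ ∘ L⁻¹` takes the permuted word
  -- `(f₀ + f) ∘ L⁻¹` to `f₀ + (g + f ∘ L⁻¹)`
  refine ⟨⟨Multiplicative.ofAdd fun i => f₀ (b i) + g (b i) + f₀ (E.symm (b i)), π⟩, ?_, rfl⟩
  refine (mem_autGroup_iff _ _).2 ?_
  rintro y ⟨f, hf, hy⟩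
  refine ⟨_, hg f hf, fun i => ?_⟩
  simp only [HammingAut.act, toAdd_ofAdd, hy, ← hE]
  linear_combination CharTwo.add_self_eq_zero (f₀ (E.symm (b i)))

end BinaryCode

theorem mainTheorem7 (N : Set (BinaryCode.Word 15))
    (hN : BinaryCode.IsPuncturedNordstromRobinson N) (hzero : (0 : BinaryCode.Word 15) ∈ N) :
    (∃ H : Submodule (ZMod 2) (BinaryCode.Word 15),
      BinaryCode.IsHammingCode 4 H ∧ N ⊆ (H : Set (BinaryCode.Word 15))) ∧
    ∀ H : Submodule (ZMod 2) (BinaryCode.Word 15),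
      BinaryCode.IsHammingCode 4 H → N ⊆ (H : Set (BinaryCode.Word 15)) →
        BinaryCode.NarrowSenseEmbedded (BinaryCode.autGroup N)
          (BinaryCode.autGroup (H : Set (BinaryCode.Word 15))) ∧
        BinaryCode.permParts (BinaryCode.autGroup N) =
          BinaryCode.symGroup (H : Set (BinaryCode.Word 15)) := by
  open BinaryCode in
  obtain ⟨b, f₀, hf₀, rfl⟩ := hN.exists_eq_puncturedKerdock hzero
  refine ⟨⟨LinearMap.ker (Fintype.linearCombination (ZMod 2) fun i => (b i : Word 4)),
    ⟨b, fun y => Iff.rfl⟩, fun y hy => sum_smul_eq_zero_of_mem_puncturedKerdock hf₀ hy⟩, ?_⟩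
  intro H hH hNH
  have mem_H := mem_hamming_iff_of_puncturedKerdock_subset hH hNH
  have hle : autGroup (puncturedKerdock b f₀) ≤ autGroup (H : Set (Word 15)) := by
    intro g hg
    rw [mem_autGroup_iff] at hg ⊢
    have hπ : ∀ y ∈ puncturedKerdock b f₀, y ∘ ⇑g.right⁻¹ ∈ H := fun y hy => by
      have h := hNH (hg y hy)
      rw [HammingAut.act_eq_act_zero_add] at h
      exact (H.add_mem_iff_right (hNH (hg 0 hzero))).1 h
    obtain ⟨L, -, hLb⟩ := exists_linearMap_of_perm fun y hy => (mem_H _).1 (hπ y hy)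
    intro y hy
    rw [HammingAut.act_eq_act_zero_add]
    refine H.add_mem (hNH (hg 0 hzero)) ((mem_H _).2 ?_)
    have h := congrArg L ((mem_H y).1 hy)
    simp only [map_sum, map_smul, hLb, map_zero] at h
    exact (sum_comp_perm_inv_smul g.right y fun i => (b i : Word 4)).trans h
  have hperm : permParts (autGroup (puncturedKerdock b f₀)) = symGroup (H : Set (Word 15)) := by
    refine le_antisymm ?_ fun π hπ => ?_
    · rw [← permParts_autGroup_submodule]
      exact Subgroup.map_mono hle
    · rw [mem_symGroup_iff] at hπ
      obtain ⟨L, hL, hLb⟩ := exists_linearMap_of_perm fun y hy => (mem_H _).1 (hπ y (hNH hy))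
      exact mem_permParts_autGroup_puncturedKerdock hL hLb
  exact ⟨⟨hle, (permParts_autGroup_submodule H).trans hperm.symm⟩, hperm⟩
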